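/- Let $B\ge 1$ be a fixed integer and $\beta\in\mathbb{R}$. For each integer $N\ge 1$ consider $N$ identical server pools, each able to hold at most $B$ simultaneous tasks. Tasks arrive as a Poisson process of rate $\lambda(N)>0$ and have independent unit-mean exponential execution times, all active tasks being executed simultaneously at unit rate. Under the JSQ$(d(N))$ scheme, where $1\le d(N)\le N$, an arriving task is immediately assigned to a pool with the minimum number of active tasks among $d(N)$ pools selected uniformly at random (either without or with replacement; ties are broken in an arbitrary, possibly randomized way depending on the current numbers of active tasks and on the sampled set of pools). A task assigned to a pool that already holds $B$ tasks is permanently discarded. Suppose that, as $N\to\infty$, $$\frac{BN-\lambda(N)}{\sqrt N}\to\beta\qquad\text{and}\qquad \frac{d(N)}{\sqrt N\,\log N}\to\infty .$$ Then for every $N\ge1$ the Markov process of the numbers of active tasks at the $N$ pools has a unique stationary distribution. Let $L^{d(N)}$ be the steady-state loss probability, i.e. the probability that a task arriving in the stationary regime is discarded. Let $L(BN,\lambda(N))$ be the steady-state loss probability of the Erlang loss system with capacity $BN$, Poisson arrivals of rate $\lambda(N)$ and unit-mean exponential service times (whose stationary distribution also exists and is unique). Then $$\lim_{N\to\infty}\sqrt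 N\,L^{d(N)}\;=\;\lim_{N\to\infty}\sqrt N\,L(BN,\lambda(N))\;=\;\frac{\phi(\beta/\sqrt B)}{\sqrt B\,\Phi(\beta/\sqrt B)},$$ where $\phi$ and $\Phi$ are the density and the distribution function of the standard normal distribution. This value is optimal: for every $N\ge 1$ and every (randomized, state-dependent) rule assigning each arriving task to one of the $N$ pools, the steady-state loss probability is at least $L(BN,\lambda(N))$. -/

import Mathlib

open Filter Topology ProbabilityTheory

noncomputable section

/-- `π` is a stationary distribution of the continuous-time Markov chain on the finite set `S`
with jump rate `q x y` from `x` to `y`: a probability vector satisfying global balance. -/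
structure IsStationaryDist {S : Type*} [Fintype S] (q : S → S → ℝ) (π : S → ℝ) : Prop where
  nonneg : ∀ x, 0 ≤ π x
  sum_eq_one : ∑ x, π x = 1
  balance : ∀ y, ∑ x, π x * q x y = π y * ∑ z, q y z

/-- States of a system of `N` server pools with buffer capacity `B`: `x i` is the number of
active tasks at pool `i`. -/
abbrev PoolState (N B : ℕ) : Type := Fin N → Fin (B + 1)

/-- `y` is obtained from `x` by adding one task at pool `i`. -/
def AddsTask {N B : ℕ} (i : Fin N) (x y : PoolState N B) : Prop :=
  (y i : ℕ) = (x i : ℕ) + 1 ∧ ∀ j, j ≠ i → y j = x j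

/-- A (randomized, state-dependent) assignment rule: in state `x`, an arriving task is assigned
to pool `i` with probability `r x i`. -/
structure IsAssignmentRule {N B : ℕ} (r : PoolState N B → Fin N → ℝ) : Prop where
  nonneg : ∀ x i, 0 ≤ r x i
  sum_eq_one : ∀ x, ∑ i, r x i = 1

open Classical in
/-- Jump rates of the system under the rule `r`: Poisson arrivals of rate `lam`, unit-mean
exponential execution times. A task assigned to a pool holding `B` tasks is discarded, so it
does not change the state (no state `y` then satisfies `AddsTask i x y`). -/
def poolRate {N B : ℕ} (r : PoolState N B → Fin N → ℝ) (lam : ℝ) (x y : PoolState N B) : ℝ :=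
  ∑ i, ((if AddsTask i x y then lam * r x i else 0)
    + (if AddsTask i y x then ((x i : ℕ) : ℝ) else 0))

/-- Probability that an arriving task is discarded, when the state it finds has law `π`. -/
def lossProb {N B : ℕ} (r : PoolState N B → Fin N → ℝ) (π : PoolState N B → ℝ) : ℝ :=
  ∑ x, π x * ∑ i, (if (x i : ℕ) = B then r x i else 0)

/-- The two ways of selecting `d` of the `N` server pools at random. -/
inductive Sampling where
  | withoutReplacement
  | withReplacement

/-- Probability that `S` is the set of sampled pools. -/
def Sampling.prob (smp : Sampling) (N d : ℕ) (S : Finset (Fin N)) : ℝ :=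
  match smp with
  | .withoutReplacement => if S.card = d then ((N.choose d : ℕ) : ℝ)⁻¹ else 0
  | .withReplacement =>
      ((Finset.univ.filter (fun f : Fin d → Fin N => Finset.univ.image f = S)).card : ℝ)
        / (N : ℝ) ^ d

/-- An arbitrary (possibly randomized) way of picking, in state `x`, a pool with the minimum
number of active tasks among the pools of the nonempty set `S`. -/
structure TieBreak (N B : ℕ) where
  prob : PoolState N B → Finset (Fin N) → Fin N → ℝ
  nonneg : ∀ x S i, 0 ≤ prob x S i
  sum_eq_one : ∀ x S, S.Nonempty → ∑ i, prob x S i = 1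
  minimal : ∀ x S i, S.Nonempty → prob x S i ≠ 0 → i ∈ S ∧ ∀ j ∈ S, x i ≤ x j

/-- The JSQ(`d`) scheme. -/
def jsqRule {N B : ℕ} (smp : Sampling) (d : ℕ) (tie : TieBreak N B)
    (x : PoolState N B) (i : Fin N) : ℝ :=
  ∑ S : Finset (Fin N), smp.prob N d S * tie.prob x S i

/-- Jump rates of the Erlang loss system with capacity `C`, arrival rate `lam` and unit-mean
exponential service times. -/
def erlangRate (C : ℕ) (lam : ℝ) (x y : Fin (C + 1)) : ℝ :=
  (if (y : ℕ) = (x : ℕ) + 1 then lam else 0)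
    + (if (x : ℕ) = (y : ℕ) + 1 then ((x : ℕ) : ℝ) else 0)

/-- The loss probability of the Erlang system with capacity `C`, when the number of active tasks
found by an arrival has law `ρ`. -/
def erlangLoss {C : ℕ} (ρ : Fin (C + 1) → ℝ) : ℝ := ρ (Fin.last C)

/-- The limiting value `φ(β/√B) / (√B Φ(β/√B))`. -/
def lossLimit (B : ℕ) (β : ℝ) : ℝ :=
  gaussianPDFReal 0 1 (β / √(B : ℝ)) / (√(B : ℝ) * cdf (gaussianReal 0 1) (β / √(B : ℝ)))

end

/-! Write e_k for the reciprocal of the Erlang loss probability with capacity k; it satisfies e_0 =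
1 and e_{k+1} = 1 + (k+1)/λ · e_k. Let h have increments e_k/λ. For any assignment rule the total
number T of tasks goes up at rate λ(1 − ℓ(x)), where ℓ(x) is the discard probability in state x, and
down at rate T. The recursion then makes the generator applied to h(T) equal to 1 − ℓ(x) e_T, so in
stationarity E[ℓ(X) e_T] = 1 exactly (`sum_stateLoss_mul_erlangInv`).

Everything follows from this identity and the monotonicity of e. Since T ≤ BN, the loss E[ℓ(X)] is
at least 1/e_{BN}, the Erlang loss. Conversely, if ℓ ≤ δ whenever T < k, the loss is at most δ +
1/e_k (`lossProb_le_add_inv_erlangInv`). Under JSQ(d) a discard requires all sampled pools to be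
full, which has probability at most exp(−(BN − T)d/(BN)) (`stateLoss_jsqRule_le_exp`). With k = BN −
f and f of order BN log N / d = o(√N), one may take δ = 1/N, negligible after scaling by √N.

It remains to see that e_k/√N has the same limit for every k = λ + β√N + o(√N). It is the integral
of a step function that converges, with a Gaussian dominating function, to exp(βt/B − t²/(2B))
(`tendsto_erlangInv_div_sqrt`). Completing the square identifies the integral as the reciprocal of
the claimed limit. -/

/-! ### Stationary distributions of finite Markov chains -/

/-- Global balance for a signed vector `v`. -/
def IsBalanced {S : Type*} [Fintype S] (q : S → S → ℝ) (v : S → ℝ) : Prop :=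
  ∀ y, ∑ x, v x * q x y = v y * ∑ z, q y z

namespace IsBalanced

variable {S : Type*} [Fintype S] {q : S → S → ℝ} {v w : S → ℝ}

theorem sub (hv : IsBalanced q v) (hw : IsBalanced q w) : IsBalanced q (fun x => v x - w x) := by
  intro y
  simp only [sub_mul, Finset.sum_sub_distrib, hv y, hw y]

theorem const_mul (hv : IsBalanced q v) (c : ℝ) : IsBalanced q (fun x => c * v x) := by
  intro y
  simp only [mul_assoc, ← Finset.mul_sum, hv y]

/-- The triangle inequality gives one inequality at each state. Summed over all states both sides
agree, so equality holds everywhere. -/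
theorem abs (hq : ∀ x y, 0 ≤ q x y) (hv : IsBalanced q v) : IsBalanced q (fun x => |v x|) := by
  have hle : ∀ y ∈ Finset.univ, |v y| * ∑ z, q y z ≤ ∑ x, |v x| * q x y := by
    intro y _
    have hout : 0 ≤ ∑ z, q y z := Finset.sum_nonneg fun z _ => hq y z
    calc |v y| * ∑ z, q y z = |∑ x, v x * q x y| := by rw [hv y, abs_mul, abs_of_nonneg hout]
      _ ≤ ∑ x, |v x * q x y| := Finset.abs_sum_le_sum_abs _ _
      _ = ∑ x, |v x| * q x y := by simp only [abs_mul, abs_of_nonneg (hq _ y)]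
  have hsum : ∑ y, |v y| * ∑ z, q y z = ∑ y, ∑ x, |v x| * q x y := by
    rw [Finset.sum_comm]
    simp only [Finset.mul_sum]
  intro y
  exact ((Finset.sum_eq_sum_iff_of_le hle).1 hsum y (Finset.mem_univ y)).symm

/-- A nonnegative balanced vector vanishing at a state that can be reached from everywhere
is zero. -/
theorem eq_zero (hq : ∀ x y, 0 ≤ q x y) (hv : IsBalanced q v) (h0 : ∀ x, 0 ≤ v x) {o : S}
    (T : S → ℕ) (hT : ∀ x, x ≠ o → ∃ y, T y < T x ∧ 0 < q x y) (ho : v o = 0) (x : S) :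
    v x = 0 := by
  induction hn : T x using Nat.strong_induction_on generalizing x with
  | _ n ih =>
    by_cases hx : x = o
    · rw [hx, ho]
    · obtain ⟨y, hy, hqy⟩ := hT x hx
      have hy0 : v y = 0 := ih (T y) (hn ▸ hy) y rfl
      have hb := hv y
      rw [hy0, zero_mul, Finset.sum_eq_zero_iff_of_nonneg
        (fun z _ => mul_nonneg (h0 z) (hq z y))] at hb
      exact (mul_eq_zero.1 (hb x (Finset.mem_univ x))).resolve_right hqy.ne'

/-- The generator matrix kills constants, so it is singular and also has a left null vector. -/
theorem exists_ne_zero [Nonempty S] (q : S → S → ℝ) : ∃ v : S → ℝ, v ≠ 0 ∧ IsBalanced q v := by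
  classical
  let M : Matrix S S ℝ := Matrix.of fun x y => q x y - if x = y then ∑ z, q y z else 0
  have hdet : M.det = 0 := by
    rw [← Matrix.exists_mulVec_eq_zero_iff]
    refine ⟨fun _ => 1, fun h => one_ne_zero (congrFun h (Classical.arbitrary S)), ?_⟩
    ext x
    simp [M, Matrix.mulVec, dotProduct, Finset.sum_sub_distrib]
  obtain ⟨v, hv, hM⟩ := Matrix.exists_vecMul_eq_zero_iff.2 hdet
  refine ⟨v, hv, fun y => ?_⟩
  have := congrFun hM y
  simpa [M, Matrix.vecMul, dotProduct, mul_sub, Finset.sum_sub_distrib, sub_eq_zero] using this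

end IsBalanced

/-- `T` is a height that some jump lowers from each state other than `o`, so `o` is reachable from
everywhere. For uniqueness, order two solutions so that their difference w is nonnegative at `o`.
Then |w| − w is balanced, nonnegative and zero at `o`, hence zero; so w ≥ 0 with total mass 0. -/
theorem existsUnique_isStationaryDist {S : Type*} [Fintype S] {q : S → S → ℝ}
    (hq : ∀ x y, 0 ≤ q x y) {o : S} (T : S → ℕ)
    (hT : ∀ x, x ≠ o → ∃ y, T y < T x ∧ 0 < q x y) :
    ∃! π : S → ℝ, IsStationaryDist q π := by
  have : Nonempty S := ⟨o⟩
  obtain ⟨v, hv0, hv⟩ := IsBalanced.exists_ne_zero q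
  have hpos : 0 < ∑ x, |v x| := by
    obtain ⟨x, hx⟩ := Function.ne_iff.1 hv0
    exact Finset.sum_pos' (fun _ _ => abs_nonneg _) ⟨x, Finset.mem_univ x, abs_pos.2 hx⟩
  have hst : IsStationaryDist q (fun x => (∑ x, |v x|)⁻¹ * |v x|) :=
    ⟨fun x => by positivity, by rw [← Finset.mul_sum, inv_mul_cancel₀ hpos.ne'],
      (hv.abs hq).const_mul _⟩
  have key : ∀ π₁ π₂ : S → ℝ, IsStationaryDist q π₁ → IsStationaryDist q π₂ → π₂ o ≤ π₁ o →
      π₁ = π₂ := by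
    intro π₁ π₂ h₁ h₂ ho
    have hw : IsBalanced q (fun x => π₁ x - π₂ x) := IsBalanced.sub h₁.balance h₂.balance
    have hu := (hw.abs hq).sub hw
    have hz := hu.eq_zero hq (fun x => sub_nonneg.2 (le_abs_self _)) T hT
      (by rw [abs_of_nonneg (sub_nonneg.2 ho), sub_self])
    have hnn : ∀ x ∈ Finset.univ, 0 ≤ π₁ x - π₂ x := fun x _ => by
      rw [← sub_eq_zero.1 (hz x)]
      exact abs_nonneg _
    have hs : ∑ x, (π₁ x - π₂ x) = 0 := by
      rw [Finset.sum_sub_distrib, h₁.sum_eq_one, h₂.sum_eq_one, sub_self]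
    funext x
    exact sub_eq_zero.1 ((Finset.sum_eq_zero_iff_of_nonneg hnn).1 hs x (Finset.mem_univ x))
  refine ⟨_, hst, ?_⟩
  intro π hπ
  rcases le_total (π o) ((∑ x, |v x|)⁻¹ * |v o|) with h | h
  · exact (key _ _ hst hπ h).symm
  · exact key _ _ hπ hst h

theorem IsStationaryDist.sum_generator_eq_zero {S : Type*} [Fintype S] {q : S → S → ℝ}
    {π : S → ℝ} (hπ : IsStationaryDist q π) (h : S → ℝ) :
    ∑ x, π x * ∑ y, q x y * (h y - h x) = 0 := by
  have h1 : ∑ x, π x * ∑ y, q x y * h y = ∑ y, h y * (π y * ∑ z, q y z) := by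
    simp only [← hπ.balance, Finset.mul_sum]
    rw [Finset.sum_comm]
    exact Finset.sum_congr rfl fun y _ => Finset.sum_congr rfl fun x _ => by ring
  have h2 : ∑ x, π x * ∑ y, q x y * h x = ∑ y, h y * (π y * ∑ z, q y z) :=
    Finset.sum_congr rfl fun y _ => by rw [← Finset.sum_mul]; ring
  simp only [mul_sub, Finset.sum_sub_distrib]
  rw [h1, h2, sub_self]

/-! ### The reciprocal of the Erlang loss formula -/

/-- `erlangInv lam k` is the reciprocal of the Erlang loss probability with capacity `k`. -/
noncomputable def erlangInv (lam : ℝ) : ℕ → ℝ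
  | 0 => 1
  | k + 1 => 1 + ((k : ℝ) + 1) / lam * erlangInv lam k

/-- A function of the number of tasks whose increments are `erlangInv lam k / lam`. -/
noncomputable def erlangPotential (lam : ℝ) (n : ℕ) : ℝ :=
  ∑ k ∈ Finset.range n, erlangInv lam k / lam

theorem erlangPotential_succ_sub (lam : ℝ) (n : ℕ) :
    erlangPotential lam (n + 1) - erlangPotential lam n = erlangInv lam n / lam := by
  simp [erlangPotential, Finset.sum_range_succ]

theorem erlangInv_pos {lam : ℝ} (hlam : 0 < lam) (k : ℕ) : 0 < erlangInv lam k := by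
  induction k with
  | zero => exact one_pos
  | succ k ih => rw [erlangInv]; positivity

theorem erlangInv_mono {lam : ℝ} (hlam : 0 < lam) : Monotone (erlangInv lam) := by
  refine monotone_nat_of_le_succ fun k => ?_
  induction k with
  | zero => simp only [erlangInv]; norm_num; positivity
  | succ k ih =>
    rw [erlangInv, erlangInv]
    push_cast
    have := erlangInv_pos hlam k
    gcongr
    linarith

/-- Unrolling the recursion gives the form whose terms can be compared with a Gaussian. -/
theorem erlangInv_eq_sum (lam : ℝ) (k : ℕ) :
    erlangInv lam k = ∑ j ∈ Finset.range (k + 1), (k.descFactorial j : ℝ) / lam ^ j := by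
  induction k with
  | zero => simp [erlangInv]
  | succ k ih =>
    rw [erlangInv, ih, Finset.sum_range_succ' _ (k + 1), Finset.mul_sum, add_comm]
    congr 1
    · refine Finset.sum_congr rfl fun j _ => ?_
      rw [Nat.succ_descFactorial_succ, pow_succ']
      push_cast
      rw [div_mul_div_comm]
    · simp

/-- The generator of a birth-death type dynamics, applied to `erlangPotential`. -/
theorem erlangPotential_drift {lam : ℝ} (hlam : lam ≠ 0) (n : ℕ) (a : ℝ) :
    lam * (1 - a) * (erlangPotential lam (n + 1) - erlangPotential lam n)
      + n * (erlangPotential lam (n - 1) - erlangPotential lam n)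
      = 1 - a * erlangInv lam n := by
  -- For positive n the recursion cancels the departure term. At n = 0 the truncated n − 1 is
  -- harmless, being multiplied by 0.
  cases n with
  | zero => rw [erlangPotential_succ_sub]; simp [erlangInv]; field_simp
  | succ n =>
    rw [erlangPotential_succ_sub, Nat.add_sub_cancel, ← neg_sub (erlangPotential lam (n + 1)),
      erlangPotential_succ_sub, erlangInv]
    push_cast
    field_simp
    ring

/-! ### The Erlang loss system -/

theorem existsUnique_erlang (C : ℕ) {lam : ℝ} (hlam : 0 < lam) :
    ∃! ρ : Fin (C + 1) → ℝ, IsStationaryDist (erlangRate C lam) ρ := by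
  refine existsUnique_isStationaryDist (o := 0) ?_ (fun x => (x : ℕ)) ?_
  · intro x y
    unfold erlangRate
    positivity
  · intro x hx
    have hx0 : 0 < (x : ℕ) := Fin.pos_iff_ne_zero.2 hx
    refine ⟨⟨x - 1, by omega⟩, Nat.sub_lt hx0 one_pos, ?_⟩
    have h : (x : ℕ) = ((x : ℕ) - 1) + 1 := by omega
    unfold erlangRate
    simp only [if_pos h]
    have : (0 : ℝ) < ((x : ℕ) : ℝ) := by exact_mod_cast hx0
    positivity

/-- Here blocking occurs only in the top state, so averaging the drift of the potential leaves 1 =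
ρ(C) e_C. -/
theorem erlangLoss_eq {C : ℕ} {lam : ℝ} (hlam : 0 < lam) {ρ : Fin (C + 1) → ℝ}
    (hρ : IsStationaryDist (erlangRate C lam) ρ) : erlangLoss ρ = (erlangInv lam C)⁻¹ := by
  have hgen : ∀ x : Fin (C + 1), ∑ y : Fin (C + 1), erlangRate C lam x y
      * (erlangPotential lam y - erlangPotential lam x)
      = 1 - (if x = Fin.last C then 1 else 0) * erlangInv lam x := by
    intro x
    rw [← erlangPotential_drift hlam.ne']
    simp only [erlangRate, add_mul, Finset.sum_add_distrib]
    congr 1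
    · by_cases hx : x = Fin.last C
      · rw [if_pos hx, sub_self, mul_zero, zero_mul]
        refine Finset.sum_eq_zero fun y _ => ?_
        rw [if_neg, zero_mul]
        have := y.isLt
        rw [hx, Fin.val_last]
        omega
      · have hlt : (x : ℕ) < C := Fin.val_lt_last hx
        rw [if_neg hx, Finset.sum_eq_single (⟨x + 1, by omega⟩ : Fin (C + 1))]
        · simp
        · intro y _ hy
          rw [if_neg, zero_mul]
          exact fun h => hy (Fin.ext h)
        · simp
    · by_cases hx : (x : ℕ) = 0
      · rw [hx]
        simp
      · rw [Finset.sum_eq_single (⟨x - 1, by omega⟩ : Fin (C + 1))]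
        · rw [if_pos (by simp; omega)]
        · intro y _ hy
          rw [if_neg, zero_mul]
          intro h
          exact hy (Fin.ext (by simp; omega))
        · simp
  have h0 := hρ.sum_generator_eq_zero (fun x => erlangPotential lam x)
  simp only [hgen] at h0
  simp only [ mul_sub, mul_one, Finset.sum_sub_distrib, hρ.sum_eq_one, ite_mul, one_mul,
    zero_mul, mul_ite, mul_zero, Finset.sum_ite_eq', Finset.mem_univ, if_true, Fin.val_last] at h0
  exact eq_inv_of_mul_eq_one_left (by unfold erlangLoss; linarith)

/-! ### Systems of server pools -/

section Pools

variable {N B : ℕ}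

/-- The total number of active tasks. -/
def totalTasks (x : PoolState N B) : ℕ := ∑ i, (x i : ℕ)

/-- The probability that a task arriving in state `x` is discarded. -/
noncomputable def stateLoss (r : PoolState N B → Fin N → ℝ) (x : PoolState N B) : ℝ :=
  ∑ i, if (x i : ℕ) = B then r x i else 0

theorem AddsTask.totalTasks_eq {i : Fin N} {x y : PoolState N B} (h : AddsTask i x y) :
    totalTasks y = totalTasks x + 1 := by
  unfold totalTasks
  rw [← Finset.add_sum_erase _ _ (Finset.mem_univ i), h.1,
    ← Finset.add_sum_erase _ (fun j => (x j : ℕ)) (Finset.mem_univ i),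
    Finset.sum_congr rfl fun j hj => by rw [h.2 j (Finset.ne_of_mem_erase hj)]]
  omega

theorem addsTask_iff_eq_update {i : Fin N} {x : PoolState N B} (hi : (x i : ℕ) + 1 < B + 1)
    (y : PoolState N B) : AddsTask i x y ↔ y = Function.update x i ⟨x i + 1, hi⟩ := by
  constructor
  · rintro ⟨h1, h2⟩
    funext j
    by_cases hj : j = i
    · subst hj
      simpa using Fin.ext h1
    · simp [hj, h2 j hj]
  · rintro rfl
    exact ⟨by simp, fun j hj => by simp [hj]⟩

theorem addsTask_iff_eq_update' {i : Fin N} {x : PoolState N B} (hi : (x i : ℕ) - 1 < B + 1)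
    (h0 : (x i : ℕ) ≠ 0) (y : PoolState N B) :
    AddsTask i y x ↔ y = Function.update x i ⟨x i - 1, hi⟩ := by
  constructor
  · rintro ⟨h1, h2⟩
    funext j
    by_cases hj : j = i
    · subst hj
      simp only [Function.update_self]
      exact Fin.ext (by simp; omega)
    · simp [hj, h2 j hj]
  · rintro rfl
    exact ⟨by simp; omega, fun j hj => by simp [hj]⟩

theorem existsUnique_pool {r : PoolState N B → Fin N → ℝ} (hr : IsAssignmentRule r) {lam : ℝ}
    (hlam : 0 < lam) : ∃! π : PoolState N B → ℝ, IsStationaryDist (poolRate r lam) π := by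
  classical
  refine existsUnique_isStationaryDist (o := fun _ => 0) ?_ totalTasks ?_
  · intro x y
    refine Finset.sum_nonneg fun i _ => ?_
    have := hr.nonneg x i
    positivity
  · intro x hx
    obtain ⟨i, hi⟩ := Function.ne_iff.1 hx
    have hi0 : (x i : ℕ) ≠ 0 := fun h => hi (Fin.ext h)
    have hlt : (x i : ℕ) - 1 < B + 1 := by omega
    have hadd := (addsTask_iff_eq_update' hlt hi0 _).2 rfl
    refine ⟨Function.update x i ⟨x i - 1, hlt⟩, ?_, ?_⟩
    · rw [hadd.totalTasks_eq]
      omega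
    · refine Finset.sum_pos' (fun j _ => ?_) ⟨i, Finset.mem_univ i, ?_⟩
      · have := hr.nonneg x j
        positivity
      · have := hr.nonneg x i
        rw [if_pos hadd]
        have : (0 : ℝ) < ((x i : ℕ) : ℝ) := by exact_mod_cast Nat.pos_of_ne_zero hi0
        positivity

/-- For a function of the total alone, the choice of pool matters only through the probability of a
discard. -/
theorem poolRate_generator {r : PoolState N B → Fin N → ℝ} (hr : IsAssignmentRule r) (lam : ℝ)
    (g : ℕ → ℝ) (x : PoolState N B) :
    ∑ y, poolRate r lam x y * (g (totalTasks y) - g (totalTasks x))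
      = lam * (1 - stateLoss r x) * (g (totalTasks x + 1) - g (totalTasks x))
        + (totalTasks x : ℕ) * (g (totalTasks x - 1) - g (totalTasks x)) := by
  classical
  have harr : ∀ i, ∑ y, (if AddsTask i x y then lam * r x i else 0)
      * (g (totalTasks y) - g (totalTasks x))
      = lam * (r x i - if (x i : ℕ) = B then r x i else 0)
        * (g (totalTasks x + 1) - g (totalTasks x)) := by
    intro i
    by_cases hi : (x i : ℕ) = B
    · rw [if_pos hi, sub_self, mul_zero, zero_mul]
      refine Finset.sum_eq_zero fun y _ => ?_
      rw [if_neg, zero_mul]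
      intro h
      have := h.1
      omega
    · have hlt : (x i : ℕ) + 1 < B + 1 := by omega
      have hadd := (addsTask_iff_eq_update hlt _).2 rfl
      rw [if_neg hi, sub_zero, Finset.sum_eq_single (Function.update x i ⟨x i + 1, hlt⟩)]
      · rw [if_pos hadd, hadd.totalTasks_eq]
      · intro y _ hy
        rw [if_neg (fun h => hy ((addsTask_iff_eq_update hlt y).1 h)), zero_mul]
      · simp
  have hdep : ∀ i, ∑ y, (if AddsTask i y x then ((x i : ℕ) : ℝ) else 0)
      * (g (totalTasks y) - g (totalTasks x))
      = ((x i : ℕ) : ℝ) * (g (totalTasks x - 1) - g (totalTasks x)) := by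
    intro i
    by_cases hi : (x i : ℕ) = 0
    · simp [hi]
    · have hlt : (x i : ℕ) - 1 < B + 1 := by omega
      have hadd := (addsTask_iff_eq_update' hlt hi _).2 rfl
      rw [Finset.sum_eq_single (Function.update x i ⟨x i - 1, hlt⟩)]
      · rw [if_pos hadd, hadd.totalTasks_eq, Nat.add_sub_cancel]
      · intro y _ hy
        rw [if_neg (fun h => hy ((addsTask_iff_eq_update' hlt hi y).1 h)), zero_mul]
      · simp
  simp only [poolRate, Finset.sum_mul, add_mul]
  rw [Finset.sum_comm]
  simp only [Finset.sum_add_distrib, harr, hdep, ← Finset.sum_mul, ← Finset.mul_sum,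
    Finset.sum_sub_distrib, hr.sum_eq_one]
  rw [stateLoss, totalTasks, Nat.cast_sum]

theorem lossProb_eq (r : PoolState N B → Fin N → ℝ) (π : PoolState N B → ℝ) :
    lossProb r π = ∑ x, π x * stateLoss r x := rfl

theorem sum_stateLoss_mul_erlangInv {r : PoolState N B → Fin N → ℝ} (hr : IsAssignmentRule r)
    {lam : ℝ} (hlam : 0 < lam) {π : PoolState N B → ℝ}
    (hπ : IsStationaryDist (poolRate r lam) π) :
    ∑ x, π x * stateLoss r x * erlangInv lam (totalTasks x) = 1 := by
  have h0 := hπ.sum_generator_eq_zero (fun x => erlangPotential lam (totalTasks x))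
  simp only [poolRate_generator hr, erlangPotential_drift hlam.ne'] at h0
  simp only [mul_sub, mul_one,
    Finset.sum_sub_distrib, hπ.sum_eq_one, ← mul_assoc] at h0
  linarith

theorem stateLoss_nonneg {r : PoolState N B → Fin N → ℝ} (hr : IsAssignmentRule r)
    (x : PoolState N B) : 0 ≤ stateLoss r x := by
  refine Finset.sum_nonneg fun i _ => ?_
  have := hr.nonneg x i
  positivity

theorem totalTasks_le (x : PoolState N B) : totalTasks x ≤ B * N := by
  calc totalTasks x ≤ ∑ _i : Fin N, B := Finset.sum_le_sum fun i _ => by omega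
    _ = B * N := by simp [mul_comm]

theorem inv_erlangInv_le_lossProb {r : PoolState N B → Fin N → ℝ} (hr : IsAssignmentRule r)
    {lam : ℝ} (hlam : 0 < lam) {π : PoolState N B → ℝ}
    (hπ : IsStationaryDist (poolRate r lam) π) :
    (erlangInv lam (B * N))⁻¹ ≤ lossProb r π := by
  rw [inv_le_iff_one_le_mul₀ (erlangInv_pos hlam _), ← sum_stateLoss_mul_erlangInv hr hlam hπ,
    lossProb_eq, Finset.sum_mul]
  refine Finset.sum_le_sum fun x _ => ?_
  exact mul_le_mul_of_nonneg_left (erlangInv_mono hlam (totalTasks_le x))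
    (mul_nonneg (hπ.nonneg x) (stateLoss_nonneg hr x))

/-- If tasks are discarded with probability at most `δ` in all states with fewer than `k` tasks,
then the loss probability exceeds that of the Erlang system of capacity `k` by at most `δ`. -/
theorem lossProb_le_add_inv_erlangInv {r : PoolState N B → Fin N → ℝ} (hr : IsAssignmentRule r)
    {lam : ℝ} (hlam : 0 < lam) {π : PoolState N B → ℝ}
    (hπ : IsStationaryDist (poolRate r lam) π) {k : ℕ} {δ : ℝ} (hδ0 : 0 ≤ δ)
    (hδ : ∀ x, totalTasks x < k → stateLoss r x ≤ δ) :
    lossProb r π ≤ δ + (erlangInv lam k)⁻¹ := by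
  have hk := erlangInv_pos hlam k
  -- Below level k the δ term bounds the loss; from k on the second term does, as e_T/e_k ≥ 1 there.
  -- The second terms sum to 1/e_k by the stationary identity.
  have hterm : ∀ x ∈ Finset.univ, π x * stateLoss r x ≤
      π x * δ + π x * stateLoss r x * erlangInv lam (totalTasks x) * (erlangInv lam k)⁻¹ := by
    intro x _
    have hp := hπ.nonneg x
    have hl := stateLoss_nonneg hr x
    have hT := erlangInv_pos hlam (totalTasks x)
    by_cases hx : totalTasks x < k
    · exact (mul_le_mul_of_nonneg_left (hδ x hx) hp).trans
        (le_add_of_nonneg_right (by positivity))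
    · have h1 : 1 ≤ erlangInv lam (totalTasks x) * (erlangInv lam k)⁻¹ := by
        rw [← div_eq_mul_inv, one_le_div hk]
        exact erlangInv_mono hlam (not_lt.1 hx)
      calc π x * stateLoss r x
          ≤ π x * stateLoss r x * (erlangInv lam (totalTasks x) * (erlangInv lam k)⁻¹) :=
            le_mul_of_one_le_right (mul_nonneg hp hl) h1
        _ ≤ _ := by rw [mul_assoc (π x * stateLoss r x)]; exact le_add_of_nonneg_left (by positivity)
  calc lossProb r π = ∑ x, π x * stateLoss r x := rfl
    _ ≤ _ := Finset.sum_le_sum hterm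
    _ = δ + (erlangInv lam k)⁻¹ := by
      rw [Finset.sum_add_distrib, ← Finset.sum_mul, ← Finset.sum_mul, hπ.sum_eq_one,
        sum_stateLoss_mul_erlangInv hr hlam hπ, one_mul, one_mul]

end Pools

/-! ### The JSQ(`d`) scheme -/

theorem descFactorial_mul_pow_le {M N : ℕ} (h : M ≤ N) (d : ℕ) :
    M.descFactorial d * N ^ d ≤ N.descFactorial d * M ^ d := by
  induction d with
  | zero => simp
  | succ d ih =>
    have h1 : (M - d) * N ≤ (N - d) * M := by
      rw [Nat.sub_mul, Nat.sub_mul, mul_comm M N]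
      exact Nat.sub_le_sub_left (Nat.mul_le_mul_left d h) _
    calc M.descFactorial (d + 1) * N ^ (d + 1)
        = ((M - d) * N) * (M.descFactorial d * N ^ d) := by
          rw [Nat.descFactorial_succ, pow_succ]; ring
      _ ≤ ((N - d) * M) * (N.descFactorial d * M ^ d) := Nat.mul_le_mul h1 ih
      _ = N.descFactorial (d + 1) * M ^ (d + 1) := by
          rw [Nat.descFactorial_succ, pow_succ]; ring

/-- Sampling without replacement is no more likely than sampling with replacement to stay inside a
given set of M elements. -/
theorem choose_mul_pow_le {M N : ℕ} (h : M ≤ N) (d : ℕ) :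
    M.choose d * N ^ d ≤ N.choose d * M ^ d := by
  have := descFactorial_mul_pow_le h d
  rw [Nat.descFactorial_eq_factorial_mul_choose, Nat.descFactorial_eq_factorial_mul_choose,
    mul_assoc, mul_assoc] at this
  exact Nat.le_of_mul_le_mul_left this d.factorial_pos

/-! ### The probability that the sample falls inside a given set of pools. -/

namespace Sampling

variable {N d : ℕ} (smp : Sampling)

theorem prob_nonneg (S : Finset (Fin N)) : 0 ≤ smp.prob N d S := by
  cases smp <;> simp only [Sampling.prob] <;> positivity

theorem nonempty_of_prob_ne_zero (hd : 1 ≤ d) {S : Finset (Fin N)} (h : smp.prob N d S ≠ 0) :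
    S.Nonempty := by
  rw [Finset.nonempty_iff_ne_empty]
  rintro rfl
  apply h
  have : NeZero d := ⟨by omega⟩
  cases smp
  · exact if_neg (by rw [Finset.card_empty]; omega)
  · simp only [Sampling.prob]
    rw [Finset.filter_false_of_mem, Finset.card_empty, Nat.cast_zero, zero_div]
    intro f _ hf
    exact Finset.univ_nonempty.ne_empty (Finset.image_eq_empty.1 hf)

theorem sum_powerset_withoutReplacement (F : Finset (Fin N)) :
    ∑ S ∈ F.powerset, Sampling.withoutReplacement.prob N d S
      = (F.card.choose d : ℝ) / (N.choose d : ℝ) := by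
  simp only [Sampling.prob]
  rw [← Finset.sum_filter, Finset.sum_const, nsmul_eq_mul, ← Finset.powersetCard_eq_filter,
    Finset.card_powersetCard, div_eq_mul_inv]

/-- The sequences with values in F are partitioned according to their image. -/
theorem sum_powerset_withReplacement (F : Finset (Fin N)) :
    ∑ S ∈ F.powerset, Sampling.withReplacement.prob N d S = (F.card : ℝ) ^ d / (N : ℝ) ^ d := by
  simp only [Sampling.prob]
  rw [← Finset.sum_div, ← Nat.cast_sum]
  congr 1
  rw [← Nat.cast_pow, Nat.cast_inj]
  have hcard : (Fintype.piFinset fun _ : Fin d => F).card = F.card ^ d := by simp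
  rw [← hcard, Finset.card_eq_sum_card_fiberwise
    (f := fun f : Fin d → Fin N => Finset.univ.image f) (t := F.powerset)]
  · refine Finset.sum_congr rfl fun S hS => ?_
    congr 1
    ext f
    simp only [Finset.mem_filter, Finset.mem_univ, true_and, Fintype.mem_piFinset]
    refine ⟨fun h => ⟨fun i => ?_, h⟩, fun h => h.2⟩
    exact Finset.mem_powerset.1 hS (h ▸ Finset.mem_image_of_mem f (Finset.mem_univ i))
  · intro f hf
    simp only [Finset.mem_coe, Fintype.mem_piFinset] at hf
    simp only [Finset.coe_powerset, Set.mem_preimage, Set.mem_powerset_iff, Finset.coe_subset]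
    intro j hj
    obtain ⟨i, _, rfl⟩ := Finset.mem_image.1 hj
    exact hf i

theorem sum_prob (hd : d ≤ N) (hN : 1 ≤ N) : ∑ S, smp.prob N d S = 1 := by
  rw [← Finset.powerset_univ]
  cases smp
  · rw [sum_powerset_withoutReplacement, Finset.card_univ, Fintype.card_fin, div_self]
    exact_mod_cast (Nat.choose_pos hd).ne'
  · rw [sum_powerset_withReplacement, Finset.card_univ, Fintype.card_fin, div_self]
    have : (0 : ℝ) < N := by exact_mod_cast hN
    positivity

theorem sum_powerset_le (hd : d ≤ N) (hN : 1 ≤ N) (F : Finset (Fin N)) :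
    ∑ S ∈ F.powerset, smp.prob N d S ≤ ((F.card : ℝ) / N) ^ d := by
  have hN' : (0 : ℝ) < N := by exact_mod_cast hN
  rw [div_pow]
  cases smp
  · rw [sum_powerset_withoutReplacement, div_le_div_iff₀ (by exact_mod_cast Nat.choose_pos hd)
      (by positivity), mul_comm ((F.card : ℝ) ^ d)]
    exact_mod_cast choose_mul_pow_le (by simpa using F.card_le_univ) d
  · rw [sum_powerset_withReplacement]

end Sampling

section JSQ

variable {N B d : ℕ} (smp : Sampling) (tie : TieBreak N B)

theorem isAssignmentRule_jsqRule (hd : 1 ≤ d) (hdN : d ≤ N) :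
    IsAssignmentRule (jsqRule smp d tie) where
  nonneg x i := Finset.sum_nonneg fun S _ => mul_nonneg (smp.prob_nonneg S) (tie.nonneg x S i)
  sum_eq_one x := by
    simp only [jsqRule]
    rw [Finset.sum_comm, ← smp.sum_prob hdN (hd.trans hdN)]
    refine Finset.sum_congr rfl fun S _ => ?_
    rw [← Finset.mul_sum]
    by_cases h : smp.prob N d S = 0
    · rw [h, zero_mul]
    · rw [tie.sum_eq_one x S (smp.nonempty_of_prob_ne_zero hd h), mul_one]

/-- A task is discarded only if all sampled pools are full. -/
theorem stateLoss_jsqRule_le_sum (hd : 1 ≤ d) (x : PoolState N B) :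
    stateLoss (jsqRule smp d tie) x
      ≤ ∑ S ∈ (Finset.univ.filter fun i => (x i : ℕ) = B).powerset, smp.prob N d S := by
  have h1 : stateLoss (jsqRule smp d tie) x
      = ∑ S, smp.prob N d S * ∑ i, if (x i : ℕ) = B then tie.prob x S i else 0 := by
    simp only [stateLoss, jsqRule, ← Finset.sum_filter]
    rw [Finset.sum_comm]
    simp only [Finset.mul_sum]
  have h2 : (Finset.univ.filter fun i => (x i : ℕ) = B).powerset
      = Finset.univ.filter fun S => S ⊆ Finset.univ.filter fun i => (x i : ℕ) = B := by
    ext S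
    simp
  rw [h1, h2, Finset.sum_filter]
  refine Finset.sum_le_sum fun S _ => ?_
  by_cases hp : smp.prob N d S = 0
  · simp [hp]
  have hS := smp.nonempty_of_prob_ne_zero hd hp
  split_ifs with hsub
  · refine mul_le_of_le_one_right (smp.prob_nonneg S) ?_
    rw [← tie.sum_eq_one x S hS]
    refine Finset.sum_le_sum fun i _ => ?_
    split_ifs
    · exact le_rfl
    · exact tie.nonneg x S i
  · rw [Finset.sum_eq_zero, mul_zero]
    intro i _
    rw [ite_eq_right_iff]
    intro hi
    -- If a full pool can be chosen, minimality forces every sampled pool to be full.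
    by_contra ht
    refine hsub fun j hj => ?_
    have hle : (x i : ℕ) ≤ x j := (tie.minimal x S i hS ht).2 j hj
    simp only [Finset.mem_filter, Finset.mem_univ, true_and]
    omega

/-- The full pools alone hold B|F| ≤ T tasks, so |F|/N ≤ 1 − (BN − T)/(BN); then use 1 + x ≤ exp x
and take the d-th power. -/
theorem stateLoss_jsqRule_le_exp (hB : 1 ≤ B) (hd : 1 ≤ d) (hdN : d ≤ N) (x : PoolState N B) :
    stateLoss (jsqRule smp d tie) x
      ≤ Real.exp (-(((B : ℝ) * N - totalTasks x) * d / (B * N))) := by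
  have hN : 1 ≤ N := hd.trans hdN
  have hN' : (0 : ℝ) < N := by exact_mod_cast hN
  have hB' : (0 : ℝ) < B := by exact_mod_cast hB
  set F := Finset.univ.filter fun i => (x i : ℕ) = B with hF
  have hFT : B * F.card ≤ totalTasks x := by
    calc B * F.card = ∑ i ∈ F, (x i : ℕ) := by
          rw [Finset.sum_congr rfl fun i hi => (Finset.mem_filter.1 hi).2, Finset.sum_const,
            smul_eq_mul, mul_comm]
      _ ≤ totalTasks x := Finset.sum_le_sum_of_subset (Finset.subset_univ _)
  have hFT' : (B : ℝ) * F.card ≤ totalTasks x := by exact_mod_cast hFT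
  have h1 : (F.card : ℝ) / N ≤ Real.exp (-(((B : ℝ) * N - totalTasks x) / (B * N))) := by
    refine le_trans ?_ (Real.add_one_le_exp _)
    have : -(((B : ℝ) * N - totalTasks x) / (B * N)) + 1 = totalTasks x / (B * N) := by
      field_simp
      ring
    rw [this, div_le_div_iff₀ hN' (by positivity)]
    nlinarith
  calc stateLoss (jsqRule smp d tie) x ≤ _ := stateLoss_jsqRule_le_sum smp tie hd x
    _ ≤ ((F.card : ℝ) / N) ^ d := smp.sum_powerset_le hdN hN F
    _ ≤ Real.exp (-(((B : ℝ) * N - totalTasks x) / (B * N))) ^ d :=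
        pow_le_pow_left₀ (by positivity) h1 d
    _ = _ := by rw [← Real.exp_nat_mul]; congr 1; ring

end JSQ

/-! ### Asymptotics of the Erlang loss formula -/

/-- Writing the sum as an integral over a fixed domain makes dominated convergence applicable. -/
theorem integral_Ioi_floor (a : ℕ → ℝ) {n : ℕ} (ha : ∀ j, n ≤ j → a j = 0) :
    ∫ t in Set.Ioi (0 : ℝ), a ⌊t⌋₊ = ∑ j ∈ Finset.range n, a j := by
  have hfloor : ∀ j : ℕ, ∀ t ∈ Set.Ioo (j : ℝ) ((j + 1 : ℕ) : ℝ), a ⌊t⌋₊ = a j := by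
    intro j t ht
    congr 1
    rw [Nat.floor_eq_iff (j.cast_nonneg.trans ht.1.le)]
    exact ⟨ht.1.le, by exact_mod_cast ht.2⟩
  have hle : ∀ j : ℕ, (j : ℝ) ≤ ((j + 1 : ℕ) : ℝ) := fun j => by push_cast; linarith
  have h1 : ∫ t in Set.Ioi (0 : ℝ), a ⌊t⌋₊ = ∫ t in Set.Ioc (0 : ℝ) n, a ⌊t⌋₊ := by
    refine (MeasureTheory.setIntegral_eq_of_subset_of_forall_sdiff_eq_zero measurableSet_Ioi
      Set.Ioc_subset_Ioi_self ?_)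
    rintro t ⟨ht, ht'⟩
    have hn : (n : ℝ) < t := by
      by_contra h
      exact ht' ⟨ht, not_lt.1 h⟩
    exact ha _ (Nat.le_floor hn.le)
  have h2 := intervalIntegral.sum_integral_adjacent_intervals
    (f := fun t : ℝ => a ⌊t⌋₊) (μ := MeasureTheory.volume) (a := fun j : ℕ => (j : ℝ)) (n := n)
    (fun j _ => by
      rw [intervalIntegrable_iff_integrableOn_Ioo_of_le (hle j)]
      exact (MeasureTheory.integrableOn_const (C := a j) (by simp)).congr_fun
        (fun t ht => (hfloor j t ht).symm) measurableSet_Ioo)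
  rw [h1, ← intervalIntegral.integral_of_le n.cast_nonneg]
  simp only [Nat.cast_zero] at h2
  rw [← h2]
  refine Finset.sum_congr rfl fun j _ => ?_
  rw [intervalIntegral.integral_congr_Ioo_of_le (hle j) (g := fun _ => a j) (hfloor j)]
  simp

theorem erlangInv_div_eq_integral (lam : ℝ) (k : ℕ) {s : ℝ} (hs : 0 < s) :
    erlangInv lam k / s
      = ∫ t in Set.Ioi (0 : ℝ), (k.descFactorial ⌊t * s⌋₊ : ℝ) / lam ^ ⌊t * s⌋₊ := by
  rw [MeasureTheory.integral_comp_mul_right_Ioi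
    (fun u : ℝ => (k.descFactorial ⌊u⌋₊ : ℝ) / lam ^ ⌊u⌋₊) 0 hs, zero_mul,
    integral_Ioi_floor (fun j => (k.descFactorial j : ℝ) / lam ^ j) (n := k + 1),
    erlangInv_eq_sum, smul_eq_mul, div_eq_inv_mul]
  intro j hj
  rw [Nat.descFactorial_eq_zero_iff_lt.2 (by omega), Nat.cast_zero, zero_div]

/-- From log(1 + x) ≥ 1 − 1/(1 + x); the remaining gap is x²(1 + 2x)/(1 + x), which explains the
threshold −1/2. -/
theorem exp_sub_two_mul_sq_le {x : ℝ} (hx : -(1 / 2) ≤ x) :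
    Real.exp (x - 2 * x ^ 2) ≤ 1 + x := by
  have hpos : 0 < 1 + x := by linarith
  rw [← Real.le_log_iff_exp_le hpos]
  refine le_trans ?_ (Real.one_sub_inv_le_log_of_pos hpos)
  have : 1 - (1 + x)⁻¹ - (x - 2 * x ^ 2) = x ^ 2 * (1 + 2 * x) / (1 + x) := by
    field_simp
    ring
  have h2 : 0 ≤ x ^ 2 * (1 + 2 * x) / (1 + x) :=
    div_nonneg (mul_nonneg (sq_nonneg x) (by linarith)) hpos.le
  linarith

/-- The exponent in the approximation of `k.descFactorial j / lam ^ j`. -/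
noncomputable def descExponent (k : ℕ) (lam : ℝ) (j : ℕ) : ℝ :=
  j * (k - lam) / lam - j * (j - 1) / (2 * lam)

/-- The exponent is the sum over i < j of (k − λ − i)/λ, the linearised logarithms of the factors (k
− i)/λ. -/
theorem descExponent_succ (k : ℕ) {lam : ℝ} (hlam : lam ≠ 0) (j : ℕ) :
    descExponent k lam (j + 1) = ((k : ℝ) - lam - j) / lam + descExponent k lam j := by
  unfold descExponent
  push_cast
  field_simp
  ring

theorem descFactorial_div_pow_le (k : ℕ) {lam : ℝ} (hlam : 0 < lam) (j : ℕ) :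
    (k.descFactorial j : ℝ) / lam ^ j ≤ Real.exp (descExponent k lam j) := by
  induction j with
  | zero => simp [descExponent]
  | succ j ih =>
    rcases lt_or_ge k (j + 1) with h | h
    · rw [Nat.descFactorial_eq_zero_iff_lt.2 h, Nat.cast_zero, zero_div]
      positivity
    · have h1 : ((k - j : ℕ) : ℝ) / lam ≤ Real.exp (((k : ℝ) - lam - j) / lam) := by
        refine le_trans (le_of_eq ?_) (Real.add_one_le_exp _)
        rw [Nat.cast_sub (by omega)]
        field_simp
        ring
      rw [descExponent_succ k hlam.ne', Real.exp_add, Nat.descFactorial_succ, pow_succ',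
        Nat.cast_mul, mul_div_mul_comm]
      exact mul_le_mul h1 ih (by positivity) (by positivity)

/-- X bounds every |(k − λ − i)/λ| with i < j, so linearising each logarithm costs at most 2X². -/
theorem le_descFactorial_div_pow (k : ℕ) {lam : ℝ} (hlam : 0 < lam) {X : ℝ} (hX : X ≤ 1 / 2)
    (j : ℕ) (hj : |(k : ℝ) - lam| + j ≤ X * lam) :
    Real.exp (descExponent k lam j - 2 * j * X ^ 2) ≤ (k.descFactorial j : ℝ) / lam ^ j := by
  induction j with
  | zero => simp [descExponent]
  | succ j ih =>
    push_cast at hj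
    set x := ((k : ℝ) - lam - j) / lam with hx
    have habs : |x| ≤ X := by
      rw [hx, abs_div, abs_of_pos hlam, div_le_iff₀ hlam]
      have := abs_sub ((k : ℝ) - lam) j
      rw [Nat.abs_cast] at this
      linarith
    have hxl := neg_le_of_abs_le habs
    have hsq : x ^ 2 ≤ X ^ 2 := sq_le_sq' hxl (le_of_abs_le habs)
    have hkj : 1 + x = ((k : ℝ) - j) / lam := by
      rw [hx]
      field_simp
      ring
    have hjk : j ≤ k := by
      have : 0 < ((k : ℝ) - j) / lam := by rw [← hkj]; linarith
      have := (div_pos_iff_of_pos_right hlam).1 this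
      exact_mod_cast (sub_pos.1 this).le
    have h1 : Real.exp (x - 2 * X ^ 2) ≤ ((k - j : ℕ) : ℝ) / lam := by
      rw [Nat.cast_sub hjk, ← hkj]
      exact (Real.exp_le_exp.2 (by linarith)).trans (exp_sub_two_mul_sq_le (by linarith))
    rw [descExponent_succ k hlam.ne', Nat.descFactorial_succ, pow_succ' lam,
      Nat.cast_mul, mul_div_mul_comm]
    calc _ = Real.exp (x - 2 * X ^ 2) * Real.exp (descExponent k lam j - 2 * j * X ^ 2) := by
          rw [← Real.exp_add]
          congr 1
          push_cast
          ring
      _ ≤ _ := mul_le_mul h1 (ih (by linarith)) (by positivity) (by positivity)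

/-- A Gaussian bound uniform in s, needed for the dominating function. -/
theorem descExponent_floor_le {B M s t lam : ℝ} {k : ℕ} (hB : 0 < B) (hs : 1 ≤ s) (ht : 0 ≤ t)
    (hM : |(k : ℝ) - lam| ≤ M * s) (hl : B / 2 * s ^ 2 ≤ lam) (hu : lam ≤ 2 * B * s ^ 2) :
    descExponent k lam ⌊t * s⌋₊ ≤ 2 * B * ((2 * M + 3) / B) ^ 2 - 1 / (8 * B) * t ^ 2 := by
  have hs0 : 0 < s := by linarith
  have hM0 : 0 ≤ M := nonneg_of_mul_nonneg_left ((abs_nonneg _).trans hM) hs0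
  have hlam : 0 < lam := lt_of_lt_of_le (by positivity) hl
  have hu0 : 0 ≤ t * s := by positivity
  set j : ℝ := (⌊t * s⌋₊ : ℝ) with hj
  have hj0 : 0 ≤ j := Nat.cast_nonneg _
  have hju : j ≤ t * s := Nat.floor_le hu0
  have h1 : j * (k - lam) / lam ≤ 2 * M / B * t := by
    rw [div_le_iff₀ hlam]
    calc j * (k - lam) ≤ (t * s) * (M * s) :=
          (mul_le_mul_of_nonneg_left ((le_abs_self _).trans hM) hj0).trans
            (mul_le_mul_of_nonneg_right hju (by positivity))
      _ = 2 * M / B * t * (B / 2 * s ^ 2) := by field_simp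
      _ ≤ 2 * M / B * t * lam := mul_le_mul_of_nonneg_left hl (by positivity)
  -- With u = ts ≥ 1, j > u − 1 gives j(j − 1) ≥ (u − 1)(u − 2); for u < 1 the left side is
  -- nonpositive and j = 0.
  have hquad : (t * s) ^ 2 - 3 * (t * s) ≤ j * (j - 1) := by
    rcases lt_or_ge (t * s) 1 with h | h
    · have : j = 0 := by rw [hj, Nat.floor_eq_zero.2 h, Nat.cast_zero]
      rw [this]
      nlinarith
    · have : t * s - 1 < j := Nat.sub_one_lt_floor _
      nlinarith
  have h2 : -(j * (j - 1) / (2 * lam)) ≤ 3 / B * t - 1 / (4 * B) * t ^ 2 := by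
    have ha : 1 / (4 * B) * t ^ 2 ≤ (t * s) ^ 2 / (2 * lam) := by
      rw [le_div_iff₀ (by positivity)]
      calc 1 / (4 * B) * t ^ 2 * (2 * lam) ≤ 1 / (4 * B) * t ^ 2 * (2 * (2 * B * s ^ 2)) := by
            gcongr
        _ = (t * s) ^ 2 := by field_simp; ring
    have hb : 3 * (t * s) / (2 * lam) ≤ 3 / B * t := by
      rw [div_le_iff₀ (by positivity)]
      calc 3 * (t * s) ≤ 3 * (t * s) * s := le_mul_of_one_le_right (by positivity) hs
        _ = 3 / B * t * (2 * (B / 2 * s ^ 2)) := by field_simp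
        _ ≤ 3 / B * t * (2 * lam) := by gcongr
    have hc : ((t * s) ^ 2 - 3 * (t * s)) / (2 * lam) ≤ j * (j - 1) / (2 * lam) := by gcongr
    rw [sub_div] at hc
    linarith
  -- Half of the quadratic term absorbs the linear one, by completing the square.
  have h3 : (2 * M + 3) / B * t - 1 / (4 * B) * t ^ 2
      ≤ 2 * B * ((2 * M + 3) / B) ^ 2 - 1 / (8 * B) * t ^ 2 := by
    have : 2 * B * ((2 * M + 3) / B) ^ 2 - 1 / (8 * B) * t ^ 2
        - ((2 * M + 3) / B * t - 1 / (4 * B) * t ^ 2)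
        = 2 * B * ((2 * M + 3) / B - t / (4 * B)) ^ 2 := by
      field_simp
      ring
    have h4 : 0 ≤ 2 * B * ((2 * M + 3) / B - t / (4 * B)) ^ 2 := by positivity
    linarith
  have h5 : 2 * M / B * t + 3 / B * t = (2 * M + 3) / B * t := by ring
  unfold descExponent
  rw [← hj]
  linarith

section

variable {B β : ℝ} {lam : ℕ → ℝ} {k : ℕ → ℕ}

theorem tendsto_sqrt_natCast_atTop : Tendsto (fun N : ℕ => √(N : ℝ)) atTop atTop :=
  Real.tendsto_sqrt_atTop.comp tendsto_natCast_atTop_atTop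

theorem tendsto_inv_sqrt_natCast : Tendsto (fun N : ℕ => (√(N : ℝ))⁻¹) atTop (𝓝 0) :=
  tendsto_inv_atTop_zero.comp tendsto_sqrt_natCast_atTop

theorem tendsto_descFactorial_div_pow (hB : 0 < B)
    (hk : Tendsto (fun N : ℕ => ((k N : ℝ) - lam N) / √(N : ℝ)) atTop (𝓝 β))
    (hl : Tendsto (fun N : ℕ => lam N / N) atTop (𝓝 B)) {t : ℝ} (ht : 0 ≤ t) :
    Tendsto (fun N : ℕ => ((k N).descFactorial ⌊t * √(N : ℝ)⌋₊ : ℝ) / lam N ^ ⌊t * √(N : ℝ)⌋₊)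
      atTop (𝓝 (Real.exp (β * t / B - t ^ 2 / (2 * B)))) := by
  set j : ℕ → ℕ := fun N => ⌊t * √(N : ℝ)⌋₊ with hj
  have hs0 := tendsto_inv_sqrt_natCast
  have hjt : Tendsto (fun N : ℕ => (j N : ℝ) / √(N : ℝ)) atTop (𝓝 t) :=
    (tendsto_nat_floor_mul_div_atTop ht).comp tendsto_sqrt_natCast_atTop
  have hev : ∀ᶠ N : ℕ in atTop, 0 < √(N : ℝ) ∧ 0 < lam N := by
    filter_upwards [eventually_gt_atTop 0, hl.eventually (lt_mem_nhds hB)] with N hN hlN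
    have hN' : (0 : ℝ) < N := by exact_mod_cast hN
    exact ⟨Real.sqrt_pos.2 hN', (div_pos_iff_of_pos_right hN').1 hlN⟩
  have hsq : ∀ N : ℕ, (N : ℝ) = √(N : ℝ) ^ 2 := fun N => (Real.sq_sqrt N.cast_nonneg).symm
  have hE : Tendsto (fun N => descExponent (k N) (lam N) (j N)) atTop
      (𝓝 (β * t / B - t ^ 2 / (2 * B))) := by
    have h := ((hjt.mul hk).div hl hB.ne').sub
      ((hjt.mul (hjt.sub hs0)).div (hl.const_mul 2) (by positivity))
    have e : t * β / B - t * (t - 0) / (2 * B) = β * t / B - t ^ 2 / (2 * B) := by ring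
    rw [e] at h
    refine h.congr' ?_
    filter_upwards [hev] with N ⟨hs, hlN⟩
    simp only [Pi.div_apply]
    unfold descExponent
    rw [hsq N]
    simp only [Real.sqrt_sq hs.le]
    field_simp
  -- The smallest X allowed in the lower bound. It is O(1/√N) while j ~ t√N, so the error 2jX²
  -- vanishes.
  set X : ℕ → ℝ := fun N => (|(k N : ℝ) - lam N| + j N) / lam N with hX
  have hXlim : Tendsto (fun N => X N * √(N : ℝ)) atTop (𝓝 ((|β| + t) / B)) := by
    refine ((hk.abs.add hjt).div hl hB.ne').congr' ?_
    filter_upwards [hev] with N ⟨hs, hlN⟩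
    simp only [Pi.div_apply, hX]
    rw [hsq N]
    simp only [Real.sqrt_sq hs.le, abs_div, abs_of_pos hs]
    field_simp
  have hX0 : Tendsto X atTop (𝓝 0) := by
    have h := hXlim.mul hs0
    rw [mul_zero] at h
    refine h.congr' ?_
    filter_upwards [hev] with N ⟨hs, _⟩
    rw [mul_assoc, mul_inv_cancel₀ hs.ne', mul_one]
  have herr : Tendsto (fun N => 2 * (j N : ℝ) * X N ^ 2) atTop (𝓝 0) := by
    have h := ((hjt.const_mul 2).mul hXlim).mul hX0
    rw [mul_zero] at h
    refine h.congr' ?_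
    filter_upwards [hev] with N ⟨hs, _⟩
    field_simp
  have hlow := (Real.continuous_exp.tendsto _).comp (hE.sub herr)
  rw [sub_zero] at hlow
  refine tendsto_of_tendsto_of_tendsto_of_le_of_le' hlow
    ((Real.continuous_exp.tendsto _).comp hE) ?_ ?_
  · filter_upwards [hev, hX0.eventually (gt_mem_nhds (show (0 : ℝ) < 1 / 2 by norm_num))]
      with N ⟨_, hlN⟩ hXN
    exact le_descFactorial_div_pow (k N) hlN hXN.le (j N) (div_mul_cancel₀ _ hlN.ne').ge
  · filter_upwards [hev] with N ⟨_, hlN⟩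
    exact descFactorial_div_pow_le (k N) hlN (j N)

theorem tendsto_erlangInv_div_sqrt (hB : 0 < B)
    (hk : Tendsto (fun N : ℕ => ((k N : ℝ) - lam N) / √(N : ℝ)) atTop (𝓝 β))
    (hl : Tendsto (fun N : ℕ => lam N / N) atTop (𝓝 B)) :
    Tendsto (fun N : ℕ => erlangInv (lam N) (k N) / √(N : ℝ)) atTop
      (𝓝 (∫ t in Set.Ioi (0 : ℝ), Real.exp (β * t / B - t ^ 2 / (2 * B)))) := by
  have hint : Tendsto (fun N : ℕ => ∫ t in Set.Ioi (0 : ℝ),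
      ((k N).descFactorial ⌊t * √(N : ℝ)⌋₊ : ℝ) / lam N ^ ⌊t * √(N : ℝ)⌋₊) atTop
      (𝓝 (∫ t in Set.Ioi (0 : ℝ), Real.exp (β * t / B - t ^ 2 / (2 * B)))) := by
    -- The dominating function is the uniform bound with M = |β| + 1, valid for all large N.
    refine MeasureTheory.tendsto_integral_filter_of_dominated_convergence
      (fun t => Real.exp (2 * B * ((2 * (|β| + 1) + 3) / B) ^ 2)
        * Real.exp (-(1 / (8 * B)) * t ^ 2)) ?_ ?_ ?_ ?_
    · refine Eventually.of_forall fun N => Measurable.aestronglyMeasurable ?_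
      exact (measurable_from_nat (f := fun n => ((k N).descFactorial n : ℝ) / lam N ^ n)).comp
        (Nat.measurable_floor.comp (measurable_id.mul_const _))
    · filter_upwards [eventually_ge_atTop 1,
        hk.abs.eventually (gt_mem_nhds (lt_add_one |β|)),
        hl.eventually (lt_mem_nhds (show B / 2 < B by linarith)),
        hl.eventually (gt_mem_nhds (show B < 2 * B by linarith))] with N hN h1 h2 h3
      have hN1 : (1 : ℝ) ≤ N := by exact_mod_cast hN
      have hN' : (0 : ℝ) < N := by linarith
      have hs : 1 ≤ √(N : ℝ) := Real.one_le_sqrt.2 hN1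
      have hs0 : 0 < √(N : ℝ) := by linarith
      have hsq : √(N : ℝ) ^ 2 = N := Real.sq_sqrt N.cast_nonneg
      rw [lt_div_iff₀ hN'] at h2
      rw [div_lt_iff₀ hN'] at h3
      rw [abs_div, abs_of_pos hs0, div_lt_iff₀ hs0] at h1
      have hlN : 0 < lam N := lt_of_le_of_lt (by positivity) h2
      refine (MeasureTheory.ae_restrict_iff' measurableSet_Ioi).2 (Eventually.of_forall ?_)
      intro t ht
      rw [Real.norm_of_nonneg (by positivity), ← Real.exp_add]
      refine (descFactorial_div_pow_le (k N) hlN _).trans (Real.exp_le_exp.2 ?_)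
      have := descExponent_floor_le hB hs (le_of_lt ht) h1.le (by rw [hsq]; exact h2.le)
        (by rw [hsq]; exact h3.le)
      linarith
    · exact ((integrable_exp_neg_mul_sq (by positivity)).const_mul _).integrableOn
    · refine (MeasureTheory.ae_restrict_iff' measurableSet_Ioi).2 (Eventually.of_forall ?_)
      intro t ht
      exact tendsto_descFactorial_div_pow hB hk hl (le_of_lt ht)
  refine hint.congr' ?_
  filter_upwards [eventually_gt_atTop 0] with N hN
  exact (erlangInv_div_eq_integral _ _ (Real.sqrt_pos.2 (by exact_mod_cast hN))).symm

end

/-! ### The limit value as a Gaussian integral. -/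

theorem cdf_gaussianReal_pos (b : ℝ) : 0 < cdf (gaussianReal 0 1) b := by
  rw [cdf_eq_real, MeasureTheory.measureReal_def]
  refine ENNReal.toReal_pos (fun h => ?_) (MeasureTheory.measure_ne_top _ _)
  have := gaussianReal_absolutelyContinuous' 0 one_ne_zero h
  simp at this

theorem cdf_gaussianReal_eq_integral (b : ℝ) :
    cdf (gaussianReal 0 1) b = ∫ u in Set.Ioi (0 : ℝ), gaussianPDFReal 0 1 (b - u) := by
  have h := (MeasureTheory.Measure.measurePreserving_sub_left MeasureTheory.volume b).setIntegral_preimage_emb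
    (measurableEmbedding_subLeft b) (gaussianPDFReal 0 1) (Set.Iic b)
  have hpre : (fun u => b - u) ⁻¹' Set.Iic b = Set.Ici 0 := by
    ext u
    simp
  rw [hpre, MeasureTheory.integral_Ici_eq_integral_Ioi] at h
  rw [h, cdf_eq_real, MeasureTheory.measureReal_def, gaussianReal_apply_eq_integral _ one_ne_zero,
    ENNReal.toReal_ofReal]
  exact MeasureTheory.integral_nonneg fun u => gaussianPDFReal_nonneg _ _ u

theorem lossLimit_pos {B : ℕ} (hB : 1 ≤ B) (β : ℝ) : 0 < lossLimit B β := by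
  have : (0 : ℝ) < B := by exact_mod_cast hB
  exact div_pos (gaussianPDFReal_pos _ _ _ one_ne_zero)
    (mul_pos (Real.sqrt_pos.2 this) (cdf_gaussianReal_pos _))

/-- With b = β/√B, completing the square gives φ(b − t/√B) = φ(b) exp(βt/B − t²/(2B)); integrating
over t > 0 yields √B Φ(b). -/
theorem integral_eq_inv_lossLimit {B : ℕ} (hB : 1 ≤ B) (β : ℝ) :
    ∫ t in Set.Ioi (0 : ℝ), Real.exp (β * t / B - t ^ 2 / (2 * B)) = (lossLimit B β)⁻¹ := by
  have hB' : (0 : ℝ) < B := by exact_mod_cast hB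
  have hs : 0 < √(B : ℝ) := Real.sqrt_pos.2 hB'
  set b := β / √(B : ℝ) with hb
  have hφ := gaussianPDFReal_pos 0 1 b one_ne_zero
  have hpt : ∀ t : ℝ, gaussianPDFReal 0 1 (b - t * (√(B : ℝ))⁻¹)
      = gaussianPDFReal 0 1 b * Real.exp (β * t / B - t ^ 2 / (2 * B)) := by
    intro t
    have key : ∀ r : ℝ, 0 < r → -(β / r - t * r⁻¹ - 0) ^ 2 / (2 * (1 : NNReal))
        = -(β / r - 0) ^ 2 / (2 * (1 : NNReal)) + (β * t / r ^ 2 - t ^ 2 / (2 * r ^ 2)) := by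
      intro r hr
      rw [NNReal.coe_one]
      field_simp
      ring
    simp only [gaussianPDFReal]
    rw [mul_assoc (√_)⁻¹, ← Real.exp_add, hb, key _ hs, Real.sq_sqrt hB'.le]
  have h := MeasureTheory.integral_comp_mul_right_Ioi
    (fun u => gaussianPDFReal 0 1 (b - u)) 0 (inv_pos.2 hs)
  simp only [hpt, zero_mul, inv_inv, smul_eq_mul] at h
  rw [← cdf_gaussianReal_eq_integral, MeasureTheory.integral_const_mul] at h
  rw [lossLimit, inv_div, ← hb, eq_div_iff hφ.ne', ← h, mul_comm]

/-! ### The Halfin-Whitt limit -/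

section HalfinWhitt

variable {B : ℕ} {β : ℝ} {lam : ℕ → ℝ}

theorem tendsto_div_of_tendsto_sqrt
    (hβ : Tendsto (fun N : ℕ => ((B : ℝ) * (N : ℝ) - lam N) / √(N : ℝ)) atTop (𝓝 β)) :
    Tendsto (fun N : ℕ => lam N / N) atTop (𝓝 (B : ℝ)) := by
  have h := (hβ.mul tendsto_inv_sqrt_natCast).const_sub (B : ℝ)
  rw [mul_zero, sub_zero] at h
  refine h.congr' ?_
  filter_upwards [eventually_gt_atTop 0] with N hN
  have hN' : (0 : ℝ) < N := by exact_mod_cast hN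
  rw [← div_eq_mul_inv, div_div, Real.mul_self_sqrt hN'.le]
  field_simp
  ring

/-- A general capacity k is allowed because the limit is needed both at BN and at BN − f with f =
o(√N). -/
theorem tendsto_sqrt_mul_inv_erlangInv (hB : 1 ≤ B) {k : ℕ → ℕ}
    (hβ : Tendsto (fun N : ℕ => ((B : ℝ) * (N : ℝ) - lam N) / √(N : ℝ)) atTop (𝓝 β))
    (hk : Tendsto (fun N : ℕ => ((k N : ℝ) - lam N) / √(N : ℝ)) atTop (𝓝 β)) :
    Tendsto (fun N : ℕ => √(N : ℝ) * (erlangInv (lam N) (k N))⁻¹) atTop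
      (𝓝 (lossLimit B β)) := by
  have h := tendsto_erlangInv_div_sqrt (by exact_mod_cast hB) hk (tendsto_div_of_tendsto_sqrt hβ)
  rw [integral_eq_inv_lossLimit hB] at h
  have h2 := h.inv₀ (inv_ne_zero (lossLimit_pos hB β).ne')
  rw [inv_inv] at h2
  refine h2.congr fun N => ?_
  rw [inv_div, div_eq_mul_inv]

theorem tendsto_sqrt_mul_lossProb_jsqRule (hB : 1 ≤ B) {d : ℕ → ℕ}
    (hlam : ∀ N, 1 ≤ N → 0 < lam N) (hd : ∀ N, 1 ≤ N → 1 ≤ d N ∧ d N ≤ N)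
    (hβ : Tendsto (fun N : ℕ => ((B : ℝ) * (N : ℝ) - lam N) / √(N : ℝ)) atTop (𝓝 β))
    (hgrowth : Tendsto (fun N : ℕ => (d N : ℝ) / (√(N : ℝ) * Real.log (N : ℝ))) atTop atTop)
    (smp : Sampling) (tie : ∀ N, TieBreak N B) {π : ∀ N, PoolState N B → ℝ}
    (hπ : ∀ N, 1 ≤ N → IsStationaryDist (poolRate (jsqRule smp (d N) (tie N)) (lam N)) (π N)) :
    Tendsto (fun N : ℕ => √(N : ℝ) * lossProb (jsqRule smp (d N) (tie N)) (π N)) atTop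
      (𝓝 (lossLimit B β)) := by
  have hB' : (0 : ℝ) < B := by exact_mod_cast hB
  have hs0 := tendsto_inv_sqrt_natCast
  -- The number of free places at which exp(−f d/(BN)) drops to 1/N; the growth of d makes it o(√N).
  set f : ℕ → ℕ := fun N => ⌈(B : ℝ) * N * Real.log N / d N⌉₊ with hf
  have hflim : Tendsto (fun N : ℕ => (f N : ℝ) / √(N : ℝ)) atTop (𝓝 0) := by
    have h := ((tendsto_inv_atTop_zero.comp hgrowth).const_mul (B : ℝ)).add hs0
    rw [mul_zero, zero_add] at h
    refine tendsto_of_tendsto_of_tendsto_of_le_of_le' tendsto_const_nhds h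
      (Eventually.of_forall fun N => by positivity) ?_
    filter_upwards [eventually_ge_atTop 1] with N hN
    have hs : 0 < √(N : ℝ) := Real.sqrt_pos.2 (by exact_mod_cast hN)
    have hlog : 0 ≤ Real.log N := Real.log_nonneg (by exact_mod_cast hN)
    have hd0 : (0 : ℝ) < d N := by exact_mod_cast (hd N hN).1
    have hle : (f N : ℝ) ≤ (B : ℝ) * N * Real.log N / d N + 1 :=
      (Nat.ceil_lt_add_one (by positivity)).le
    simp only [Function.comp_apply]
    rw [div_le_iff₀ hs, inv_div, add_mul, inv_mul_cancel₀ hs.ne']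
    refine hle.trans (le_of_eq ?_)
    congr 1
    nth_rw 1 [← Real.mul_self_sqrt N.cast_nonneg]
    field_simp
  have hfle : ∀ᶠ N : ℕ in atTop, 1 ≤ N ∧ f N ≤ B * N := by
    filter_upwards [eventually_ge_atTop 1, hflim.eventually (gt_mem_nhds one_pos)] with N hN hfN
    have hN1 : (1 : ℝ) ≤ N := by exact_mod_cast hN
    have hs : 0 < √(N : ℝ) := Real.sqrt_pos.2 (by linarith)
    rw [div_lt_iff₀ hs, one_mul] at hfN
    have h1 : (f N : ℝ) ≤ N := hfN.le.trans (Real.sqrt_le_iff.2 ⟨by linarith, by nlinarith⟩)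
    refine ⟨hN, ?_⟩
    have h2 : f N ≤ N := by exact_mod_cast h1
    exact h2.trans (Nat.le_mul_of_pos_left N hB)
  have hk : Tendsto (fun N : ℕ => (((B * N - f N : ℕ) : ℝ) - lam N) / √(N : ℝ)) atTop (𝓝 β) := by
    have h := hβ.sub hflim
    rw [sub_zero] at h
    refine h.congr' ?_
    filter_upwards [hfle] with N ⟨_, hfN⟩
    rw [Nat.cast_sub hfN]
    push_cast
    ring
  have hlower : Tendsto (fun N : ℕ => √(N : ℝ) * (erlangInv (lam N) (B * N))⁻¹) atTop
      (𝓝 (lossLimit B β)) :=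
    tendsto_sqrt_mul_inv_erlangInv hB hβ (by simpa using hβ)
  -- The summand 1/√N is √N · δ with δ = 1/N.
  have hupper := hs0.add (tendsto_sqrt_mul_inv_erlangInv hB hβ hk)
  rw [zero_add] at hupper
  refine tendsto_of_tendsto_of_tendsto_of_le_of_le' hlower hupper ?_ ?_
  · filter_upwards [eventually_ge_atTop 1] with N hN
    exact mul_le_mul_of_nonneg_left (inv_erlangInv_le_lossProb
      (isAssignmentRule_jsqRule smp _ (hd N hN).1 (hd N hN).2) (hlam N hN) (hπ N hN))
      (Real.sqrt_nonneg _)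
  · filter_upwards [hfle] with N ⟨hN, hfN⟩
    have hN' : (0 : ℝ) < N := by exact_mod_cast hN
    have hs : 0 < √(N : ℝ) := Real.sqrt_pos.2 hN'
    have hd0 : (0 : ℝ) < d N := by exact_mod_cast (hd N hN).1
    have hloss := lossProb_le_add_inv_erlangInv
      (isAssignmentRule_jsqRule smp (tie N) (hd N hN).1 (hd N hN).2) (hlam N hN) (hπ N hN)
      (k := B * N - f N) (δ := (N : ℝ)⁻¹) (by positivity) (fun x hx => by
        refine (stateLoss_jsqRule_le_exp smp (tie N) hB (hd N hN).1 (hd N hN).2 x).trans ?_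
        rw [← Real.exp_log (inv_pos.2 hN'), Real.log_inv]
        refine Real.exp_le_exp.2 (neg_le_neg ?_)
        have hfree : (f N : ℝ) ≤ (B : ℝ) * N - totalTasks x := by
          have : f N + totalTasks x ≤ B * N := by omega
          have : (f N : ℝ) + totalTasks x ≤ (B : ℝ) * N := by exact_mod_cast this
          linarith
        have hceil : (B : ℝ) * N * Real.log N / d N ≤ f N := Nat.le_ceil _
        rw [div_le_iff₀ hd0] at hceil
        rw [le_div_iff₀ (by positivity)]
        calc Real.log N * (B * N) = (B : ℝ) * N * Real.log N := by ring
          _ ≤ f N * d N := hceil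
          _ ≤ _ := mul_le_mul_of_nonneg_right hfree hd0.le)
    calc _ ≤ √(N : ℝ) * ((N : ℝ)⁻¹ + (erlangInv (lam N) (B * N - f N))⁻¹) :=
          mul_le_mul_of_nonneg_left hloss hs.le
      _ = _ := by
        rw [mul_add]
        congr 1
        nth_rw 2 [← Real.mul_self_sqrt hN'.le]
        field_simp

end HalfinWhitt

theorem mainTheorem6 (B : ℕ) (hB : 1 ≤ B) (β : ℝ) (lam : ℕ → ℝ) (d : ℕ → ℕ)
    (hlam : ∀ N, 1 ≤ N → 0 < lam N)
    (hd : ∀ N, 1 ≤ N → 1 ≤ d N ∧ d N ≤ N)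
    (hβ : Tendsto (fun N : ℕ => ((B : ℝ) * (N : ℝ) - lam N) / √(N : ℝ)) atTop (𝓝 β))
    (hgrowth : Tendsto (fun N : ℕ => (d N : ℝ) / (√(N : ℝ) * Real.log (N : ℝ))) atTop atTop)
    (smp : Sampling) (tie : ∀ N, TieBreak N B) :
    -- the steady states exist and are unique
    (∀ N, 1 ≤ N →
      (∃! π : PoolState N B → ℝ, IsStationaryDist (poolRate (jsqRule smp (d N) (tie N)) (lam N)) π) ∧
      (∃! ρ : Fin (B * N + 1) → ℝ, IsStationaryDist (erlangRate (B * N) (lam N)) ρ)) ∧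
    -- the scaled loss probability of the JSQ scheme
    (∀ π : ∀ N, PoolState N B → ℝ,
      (∀ N, 1 ≤ N → IsStationaryDist (poolRate (jsqRule smp (d N) (tie N)) (lam N)) (π N)) →
      Tendsto (fun N : ℕ => √(N : ℝ) * lossProb (jsqRule smp (d N) (tie N)) (π N)) atTop
        (𝓝 (lossLimit B β))) ∧
    -- the scaled loss probability of the Erlang loss system
    (∀ ρ : ∀ N : ℕ, Fin (B * N + 1) → ℝ,
      (∀ N, 1 ≤ N → IsStationaryDist (erlangRate (B * N) (lam N)) (ρ N)) →
      Tendsto (fun N : ℕ => √(N : ℝ) * erlangLoss (ρ N)) atTop (𝓝 (lossLimit B β))) ∧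
    -- no assignment rule has a smaller loss probability than the Erlang loss system
    (∀ N, 1 ≤ N → ∀ r : PoolState N B → Fin N → ℝ, IsAssignmentRule r →
      ∀ (π : PoolState N B → ℝ) (ρ : Fin (B * N + 1) → ℝ),
        IsStationaryDist (poolRate r (lam N)) π → IsStationaryDist (erlangRate (B * N) (lam N)) ρ →
        erlangLoss ρ ≤ lossProb r π) := by
  refine ⟨fun N hN => ⟨existsUnique_pool (isAssignmentRule_jsqRule smp (tie N) (hd N hN).1
    (hd N hN).2) (hlam N hN), existsUnique_erlang _ (hlam N hN)⟩, fun π hπ =>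
    tendsto_sqrt_mul_lossProb_jsqRule hB hlam hd hβ hgrowth smp tie hπ, fun ρ hρ => ?_,
    fun N hN r hr π ρ hπ hρ => ?_⟩
  · refine (tendsto_sqrt_mul_inv_erlangInv hB (k := fun N => B * N) hβ
      (by simpa using hβ)).congr' ?_
    filter_upwards [eventually_ge_atTop 1] with N hN
    rw [erlangLoss_eq (hlam N hN) (hρ N hN)]
  · rw [erlangLoss_eq (hlam N hN) hρ]
    exact inv_erlangInv_le_lossProb hr (hlam N hN) hπ
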